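/- **Theorem 3.4.** For $n\ge 1$ let $L_n$ be the linear hexagonal chain with $n$ hexagons: its vertices are $p_0,\dots,p_n$, $q_0,\dots,q_n$, $u_0,\dots,u_{n-1}$, $v_0,\dots,v_{n-1}$, and its edges are $p_iq_i$ ($0\le i\le n$) and $p_iu_i,\ u_ip_{i+1},\ q_iv_i,\ v_iq_{i+1}$ ($0\le i\le n-1$), so that the $i$-th hexagon is the cycle $p_{i-1},u_{i-1},p_i,q_i,v_{i-1},q_{i-1}$. Let $r(a,b)$ be the resistance distance between vertices $a,b$ of $L_n$, that is, the effective resistance between $a$ and $b$ when every edge is a unit resistor. Then 1. $r(p_0,p_n)\ge r(p_j,p_i)\ge r\bigl(p_{\lfloor (n-1)/2\rfloor},p_{\lfloor (n-1)/2\rfloor+1}\bigr)$ for $0\le j<i\le n$; 2. $r(q_0,p_n)\ge r(q_j,p_i)\ge r\bigl(q_{\lfloor n/2\rfloor},p_{\lfloor n/2\rfloor}\bigr)$ for $0\le j\le i\le n$; 3. $r(u_0,u_{n-1})\ge r(u_j,u_i)\ge r\bigl(u_{\lfloor (n-1)/2\rfloor},u_{\lfloor (n-1)/2\rfloor+1}\bigr)$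 for $0\le j<i\le n-1$; 4. $r(v_0,u_{n-1})\ge r(v_j,u_i)\ge r\bigl(v_{\lfloor n/2\rfloor},u_{\lfloor n/2\rfloor}\bigr)$ for $0\le j\le i\le n-1$; 5. $r(p_0,u_{n-1})\ge r(p_j,u_i)\ge r\bigl(p_{\lfloor n/2\rfloor},u_{\lfloor n/2\rfloor}\bigr)$ for $0\le j\le i\le n-1$; 6. $r(p_0,v_{n-1})\ge r(p_j,v_i)\ge r\bigl(p_{\lfloor n/2\rfloor},v_{\lfloor n/2\rfloor}\bigr)$ for $0\le j\le i\le n-1$. (For $n=1$ item 3 is vacuous, as there are no indices $0\le j<i\le 0$.) -/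

import Mathlib

section ResistanceDistance

variable {V : Type*} [Fintype V] [DecidableEq V]

/-- `φ` is an electric potential on `G` (every edge being a unit resistor) which drives a unit
current into the network at `a` and out of it at `b`: Kirchhoff's current law together with Ohm's
law says that `L φ = e_a - e_b`, where `L` is the Laplacian matrix of `G`. -/
def IsUnitPotential (G : SimpleGraph V) [DecidableRel G.Adj] (a b : V) (φ : V → ℝ) : Prop :=
  Matrix.mulVec (G.lapMatrix ℝ) φ = Pi.single a 1 - Pi.single b 1

open Classical in
/-- The resistance distance (effective resistance) `r_G(a, b)` of a graph with unit resistors on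
its edges: the potential difference `φ a - φ b` needed to send a unit current from `a` to `b`.
A potential exists as soon as `a` and `b` are joined by a path
(`exists_isUnitPotential`), and the difference does not depend on its choice
(`resistanceDist_eq`). The value `0` when no potential exists is irrelevant for connected
graphs. -/
noncomputable def resistanceDist (G : SimpleGraph V) [DecidableRel G.Adj] (a b : V) : ℝ :=
  if h : ∃ φ : V → ℝ, IsUnitPotential G a b φ then h.choose a - h.choose b else 0

theorem exists_isUnitPotential (G : SimpleGraph V) [DecidableRel G.Adj] {a b : V}
    (hab : G.Reachable a b) : ∃ φ : V → ℝ, IsUnitPotential G a b φ := by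
  by_contra hne
  have hmem : (Pi.single a 1 - Pi.single b 1 : V → ℝ) ∉
      LinearMap.range (Matrix.toLin' (G.lapMatrix ℝ)) := by
    rintro ⟨φ, hφ⟩
    exact hne ⟨φ, by simpa [IsUnitPotential, Matrix.toLin'_apply] using hφ⟩
  obtain ⟨f, hf, hle⟩ := Submodule.exists_le_ker_of_notMem hmem
  apply hf
  have hdot : ∀ x : V → ℝ, f x = dotProduct (fun i => f (Pi.single i 1)) x := by
    intro x
    conv_lhs => rw [pi_eq_sum_univ' x]
    simp [dotProduct, map_sum, mul_comm]
  have hy : Matrix.mulVec (G.lapMatrix ℝ) (fun i => f (Pi.single i 1)) = 0 := by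
    apply dotProduct_eq_zero
    intro x
    have h1 : f (Matrix.mulVec (G.lapMatrix ℝ) x) = 0 :=
      hle ⟨x, Matrix.toLin'_apply _ _⟩
    rw [hdot, Matrix.dotProduct_mulVec, ← Matrix.mulVec_transpose, (G.isSymm_lapMatrix (R := ℝ)).eq] at h1
    exact h1
  have hc := (G.lapMatrix_mulVec_eq_zero_iff_forall_reachable).1 hy a b hab
  rw [map_sub]
  exact sub_eq_zero.2 hc

theorem resistanceDist_eq (G : SimpleGraph V) [DecidableRel G.Adj] {a b : V} {φ : V → ℝ}
    (hφ : IsUnitPotential G a b φ) : resistanceDist G a b = φ a - φ b := by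
  have h : ∃ φ : V → ℝ, IsUnitPotential G a b φ := ⟨φ, hφ⟩
  have key : ∀ ψ χ : V → ℝ, IsUnitPotential G a b ψ →
      dotProduct χ (Matrix.mulVec (G.lapMatrix ℝ) ψ) = χ a - χ b := by
    intro ψ χ hψ
    rw [show Matrix.mulVec (G.lapMatrix ℝ) ψ = Pi.single a 1 - Pi.single b 1 from hψ]
    simp [dotProduct_sub]
  have h1 := key φ h.choose hφ
  have h2 := key h.choose φ h.choose_spec
  rw [Matrix.dotProduct_mulVec, ← Matrix.mulVec_transpose,
    (G.isSymm_lapMatrix (R := ℝ)).eq, dotProduct_comm] at h1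
  rw [resistanceDist, dif_pos h]
  exact h1.symm.trans h2

end ResistanceDistance

/-- The vertices of the linear hexagonal chain with `n` hexagons:
`p_0, …, p_n`, `q_0, …, q_n`, `u_0, …, u_{n-1}`, `v_0, …, v_{n-1}`. -/
inductive HexVertex (n : ℕ) : Type
  | p (i : Fin (n + 1)) : HexVertex n
  | q (i : Fin (n + 1)) : HexVertex n
  | u (i : Fin n) : HexVertex n
  | v (i : Fin n) : HexVertex n
  deriving DecidableEq, Fintype

/-- The edges of the linear hexagonal chain, each listed in one direction: the rungs `p_i q_i`,
and `u_i p_i`, `u_i p_{i+1}`, `v_i q_i`, `v_i q_{i+1}`. -/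
def HexVertex.Edge {n : ℕ} : HexVertex n → HexVertex n → Prop
  | .p i, .q j => i = j
  | .u i, .p j => j = i.castSucc ∨ j = i.succ
  | .v i, .q j => j = i.castSucc ∨ j = i.succ
  | _, _ => False

instance HexVertex.decidableRelEdge {n : ℕ} :
    DecidableRel (HexVertex.Edge : HexVertex n → HexVertex n → Prop) := fun x y => by
  cases x <;> cases y <;> unfold HexVertex.Edge <;> infer_instance

/-- The linear hexagonal chain `L_n`: `n` hexagons in a row, the `i`-th one (`1 ≤ i ≤ n`) being the
cycle `p_{i-1}, u_{i-1}, p_i, q_i, v_{i-1}, q_{i-1}`; consecutive hexagons share the edge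
`p_i q_i`. -/
def hexChain (n : ℕ) : SimpleGraph (HexVertex n) := SimpleGraph.fromRel HexVertex.Edge

instance hexChainDecidableRel (n : ℕ) : DecidableRel (hexChain n).Adj := fun x y =>
  decidable_of_iff (x ≠ y ∧ (HexVertex.Edge x y ∨ HexVertex.Edge y x))
    (SimpleGraph.fromRel_adj _ x y).symm

theorem hexChain_preconnected (n : ℕ) : (hexChain n).Preconnected := by
  have adj : ∀ {x y : HexVertex n}, x ≠ y → HexVertex.Edge x y → (hexChain n).Reachable y x :=
    fun hne h => SimpleGraph.Adj.reachable
      ((SimpleGraph.fromRel_adj _ _ _).2 ⟨hne.symm, Or.inr h⟩)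
  have hu0 : ∀ i : Fin n, (hexChain n).Reachable (.p i.castSucc) (.u i) :=
    fun i => adj (by simp) (Or.inl rfl)
  have hu1 : ∀ i : Fin n, (hexChain n).Reachable (.p i.succ) (.u i) :=
    fun i => adj (by simp) (Or.inr rfl)
  have hv0 : ∀ i : Fin n, (hexChain n).Reachable (.q i.castSucc) (.v i) :=
    fun i => adj (by simp) (Or.inl rfl)
  have hpq : ∀ i : Fin (n + 1), (hexChain n).Reachable (.q i) (.p i) :=
    fun i => adj (by simp) rfl
  have hp : ∀ i : Fin (n + 1), (hexChain n).Reachable (.p 0) (.p i) := by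
    intro i
    induction i using Fin.induction with
    | zero => exact SimpleGraph.Reachable.refl _
    | succ i ih => exact ih.trans ((hu0 i).trans (hu1 i).symm)
  have hall : ∀ x : HexVertex n, (hexChain n).Reachable (.p 0) x := by
    rintro (i | i | i | i)
    · exact hp i
    · exact (hp i).trans (hpq i).symm
    · exact (hp _).trans (hu0 i)
    · exact (hp _).trans ((hpq _).symm.trans (hv0 i))
  exact fun x y => (hall x).symm.trans (hall y)

section IndexBounds

theorem half_lt_of_one_le {n : ℕ} (hn : 1 ≤ n) : n / 2 < n := by omega

theorem half_lt_succ (n : ℕ) : n / 2 < n + 1 := by omega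

theorem half_pred_lt_succ (n : ℕ) : (n - 1) / 2 < n + 1 := by omega

theorem half_pred_succ_lt_succ {n : ℕ} (hn : 1 ≤ n) : (n - 1) / 2 + 1 < n + 1 := by omega

theorem pred_lt_of_one_le {n : ℕ} (hn : 1 ≤ n) : n - 1 < n := by omega

theorem half_pred_lt {n : ℕ} (hn : 1 ≤ n) : (n - 1) / 2 < n := by omega

/-- If there are two different indices `j < i` in `{0, …, n - 1}`, then the upper central index
`⌊(n - 1) / 2⌋ + 1` also lies in this range. -/
theorem half_pred_succ_lt {n : ℕ} {j i : Fin n} (h : j < i) : (n - 1) / 2 + 1 < n := by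
  have hi := i.isLt
  have hji : j.val < i.val := h
  omega

end IndexBounds

/-!
The reflection exchanging `p` with `q` and `u` with `v` splits the network into a symmetric and an
antisymmetric half. In the symmetric half the rungs carry no current, and what remains is a path
with positions `0, …, 2 n`, whose resistance is `|x - y|`. In the antisymmetric half each rung
joins its vertex to the ground with conductance `2`, and this grounded path has a Green function
`G`. Hence the resistance between vertices at positions `x` and `y` is
`(|x - y| + G(x, x) + G(y, y) - 2 ε G(x, y)) / 2`, where `ε = 1` on the same side and `ε = -1` on
opposite sides (`resistanceDist_hexChain`).

By the maximum principle `0 < G(x, y) ≤ G(y, y)`, and `G(y, y)` is at most `1 / 2` at even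
positions and between `1 / 2` and `3 / 4` at odd ones. So widening a pair by a hexagon increases
the resistance (`chainResistance_le_of_subset`). This gives the maxima, and reduces the minima to
pairs in neighbouring or equal positions.

With `θ = arsinh 1` the Green function is a product of hyperbolic cosines of multiples of `θ`, thus
a sum of one term in `x - y` and a multiple of `cosh ((2 n - x - y) θ)`
(`chainGreen_eq_chainCosh`). The resistance of a neighbouring pair is therefore a constant plus
a positive combination of terms `cosh (m θ)`, where `|m|` is smallest when the pair is at the
centre.
-/

/-! ### Hyperbolic functions of the angle `arsinh 1` -/

/-- The number `θ = arsinh 1 = log (1 + √2)`, for which `sinh θ = 1` and `cosh θ = √2`. On the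
path `p_0, u_0, p_1, …` the solutions of the equation of the antisymmetric potentials grow like
`exp (x θ)`. -/
noncomputable def chainAngle : ℝ := Real.arsinh 1

theorem sinh_chainAngle : Real.sinh chainAngle = 1 := Real.sinh_arsinh 1

theorem cosh_chainAngle : Real.cosh chainAngle = √2 := by
  rw [chainAngle, Real.cosh_arsinh]; norm_num

theorem chainAngle_pos : 0 < chainAngle := Real.arsinh_pos_iff.2 one_pos

theorem cosh_add_chainAngle (z : ℝ) :
    Real.cosh (z + chainAngle) = √2 * Real.cosh z + Real.sinh z := by
  rw [Real.cosh_add, sinh_chainAngle, cosh_chainAngle]; ring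

theorem cosh_sub_chainAngle (z : ℝ) :
    Real.cosh (z - chainAngle) = √2 * Real.cosh z - Real.sinh z := by
  rw [Real.cosh_sub, sinh_chainAngle, cosh_chainAngle]; ring

theorem sqrt_two_mul_self : √2 * √2 = (2 : ℝ) := Real.mul_self_sqrt (by norm_num)

/-- `cosh (k θ)`. -/
noncomputable def chainCosh (k : ℤ) : ℝ := Real.cosh (k * chainAngle)

theorem chainCosh_pos (k : ℤ) : 0 < chainCosh k := Real.cosh_pos _

theorem chainCosh_succ_add_pred (k : ℤ) : chainCosh (k + 1) + chainCosh (k - 1) =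
    2 * √2 * chainCosh k := by
  have h1 : ((k + 1 : ℤ) : ℝ) * chainAngle = k * chainAngle + chainAngle := by push_cast; ring
  have h2 : ((k - 1 : ℤ) : ℝ) * chainAngle = k * chainAngle - chainAngle := by push_cast; ring
  rw [chainCosh, chainCosh, chainCosh, h1, h2, cosh_add_chainAngle, cosh_sub_chainAngle]
  ring

theorem chainCosh_mul (k l : ℤ) : chainCosh k * chainCosh l =
    (chainCosh (k + l) + chainCosh (k - l)) / 2 := by
  have h1 : ((k + l : ℤ) : ℝ) * chainAngle = k * chainAngle + l * chainAngle := by push_cast; ring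
  have h2 : ((k - l : ℤ) : ℝ) * chainAngle = k * chainAngle - l * chainAngle := by push_cast; ring
  rw [chainCosh, chainCosh, chainCosh, chainCosh, h1, h2, Real.cosh_add, Real.cosh_sub]
  ring

theorem chainCosh_le_chainCosh {k l : ℤ} (h : |k| ≤ |l|) : chainCosh k ≤ chainCosh l := by
  rw [chainCosh, chainCosh, Real.cosh_le_cosh, abs_mul, abs_mul]
  exact mul_le_mul_of_nonneg_right (by exact_mod_cast h) (abs_nonneg _)

/-! ### Homogeneous solutions on the grounded path -/

/-- The amplitude `√2 / 2` at even positions (vertices on a rung) and `1` at odd positions. -/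
noncomputable def chainWeight (x : ℤ) : ℝ := if Even x then √2 / 2 else 1

theorem chainWeight_even {x : ℤ} (h : Even x) : chainWeight x = √2 / 2 := if_pos h

theorem chainWeight_odd {x : ℤ} (h : Odd x) : chainWeight x = 1 := if_neg (Int.not_even_iff_odd.2 h)

theorem chainWeight_pos (x : ℤ) : 0 < chainWeight x := by
  unfold chainWeight; split_ifs <;> positivity

theorem chainWeight_mul_chainWeight_succ (x : ℤ) : chainWeight x * chainWeight (x + 1) =
    √2 / 2 := by
  rcases Int.even_or_odd x with h | h
  · rw [chainWeight_even h, chainWeight_odd h.add_one, mul_one]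
  · rw [chainWeight_odd h, chainWeight_even h.add_one, one_mul]

/-- The solution `1, 3, 5, 17, 29, 99, …` of the homogeneous equation of the grounded path
which satisfies the left boundary condition `chainHarmonic_neg_one`. -/
noncomputable def chainHarmonic (x : ℤ) : ℝ := chainWeight x * chainCosh (x + 1)

theorem chainHarmonic_pos (x : ℤ) : 0 < chainHarmonic x :=
  mul_pos (chainWeight_pos _) (chainCosh_pos _)

/-- At a rung vertex the conductances add up to `4`: two along the path and `2` to the ground. -/
theorem chainHarmonic_even {x : ℤ} (h : Even x) : chainHarmonic (x - 1) + chainHarmonic (x + 1) =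
    4 * chainHarmonic x := by
  have := chainCosh_succ_add_pred (x + 1)
  rw [chainHarmonic, chainHarmonic, chainHarmonic, chainWeight_even h, chainWeight_odd h.add_one,
    chainWeight_odd (h.sub_odd odd_one)]
  rw [show x - 1 + 1 = x + 1 - 1 by ring]
  linear_combination this

theorem chainHarmonic_odd {x : ℤ} (h : Odd x) : chainHarmonic (x - 1) + chainHarmonic (x + 1) =
    2 * chainHarmonic x := by
  have := chainCosh_succ_add_pred (x + 1)
  rw [chainHarmonic, chainHarmonic, chainHarmonic, chainWeight_odd h, chainWeight_even h.add_one,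
    chainWeight_even (h.sub_odd odd_one)]
  rw [show x - 1 + 1 = x + 1 - 1 by ring]
  linear_combination √2 / 2 * this + chainCosh (x + 1) * sqrt_two_mul_self

/-- A fictitious vertex at `-1` carries the same value as the end `0`, so that no current flows
between them: the equation of an interior vertex holds at the end as well. -/
theorem chainHarmonic_neg_one : chainHarmonic (-1) = chainHarmonic 0 := by
  rw [chainHarmonic, chainHarmonic, chainWeight_odd (by decide), chainWeight_even (by decide)]
  simp only [chainCosh]
  norm_num [cosh_chainAngle]
  linear_combination -sqrt_two_mul_self / 2

theorem chainHarmonic_le_succ {x : ℤ} (hx : -1 ≤ x) : chainHarmonic x ≤ chainHarmonic (x + 1) := by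
  have key : ∀ k : ℕ, chainHarmonic ((k : ℤ) - 1) ≤ chainHarmonic k := by
    intro k
    induction k with
    | zero => simpa using chainHarmonic_neg_one.le
    | succ k ih =>
      have h0 := chainHarmonic_pos k
      push_cast
      rw [add_sub_cancel_right]
      rcases Int.even_or_odd (k : ℤ) with h | h
      · linarith [chainHarmonic_even h]
      · linarith [chainHarmonic_odd h]
  have := key (x + 1).toNat
  rw [Int.toNat_of_nonneg (by omega), add_sub_cancel_right] at this
  exact this

theorem chainHarmonic_mono {x y : ℤ} (hx : -1 ≤ x) (hxy : x ≤ y) : chainHarmonic x ≤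
    chainHarmonic y := by
  induction y, hxy using Int.leInduction with
  | base => exact le_rfl
  | succ y hy ih => exact ih.trans (chainHarmonic_le_succ (hx.trans hy))

/-- `sinh ((2 n + 2) θ)`, the Wronskian of `chainHarmonic` and its reflection up to a constant. -/
noncomputable def chainSinh (n : ℕ) : ℝ := Real.sinh ((2 * n + 2) * chainAngle)

theorem chainSinh_pos (n : ℕ) : 0 < chainSinh n :=
  Real.sinh_pos_iff.2 (mul_pos (by positivity) chainAngle_pos)

theorem chainCosh_top (n : ℕ) : chainCosh (2 * n + 3) - chainCosh (2 * n + 1) =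
    2 * chainSinh n := by
  have h1 : ((2 * n + 3 : ℤ) : ℝ) * chainAngle = (2 * n + 2) * chainAngle + chainAngle := by
    push_cast; ring
  have h2 : ((2 * n + 1 : ℤ) : ℝ) * chainAngle = (2 * n + 2) * chainAngle - chainAngle := by
    push_cast; ring
  rw [chainCosh, chainCosh, h1, h2, cosh_add_chainAngle, cosh_sub_chainAngle, chainSinh]
  ring

theorem chainWeight_reflect (n : ℕ) (x : ℤ) : chainWeight (2 * n - x) = chainWeight x := by
  simp [chainWeight, Int.even_sub]

theorem chainHarmonic_wronskian (n : ℕ) (x : ℤ) :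
      chainHarmonic (x + 1) * chainHarmonic (2 * n - x) -
          chainHarmonic x * chainHarmonic (2 * n - (x + 1)) =
        √2 / 2 * chainSinh n := by
  have h1 := chainCosh_mul (x + 1 + 1) (2 * n - x + 1)
  have h2 := chainCosh_mul (x + 1) (2 * n - (x + 1) + 1)
  have h3 := chainWeight_mul_chainWeight_succ x
  have h4 := chainCosh_top n
  rw [show x + 1 + 1 + (2 * n - x + 1) = 2 * (n : ℤ) + 3 by ring,
    show x + 1 + 1 - (2 * n - x + 1) = 2 * x + 1 - 2 * (n : ℤ) by ring] at h1
  rw [show x + 1 + (2 * n - (x + 1) + 1) = 2 * (n : ℤ) + 1 by ring,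
    show x + 1 - (2 * n - (x + 1) + 1) = 2 * x + 1 - 2 * (n : ℤ) by ring] at h2
  simp only [chainHarmonic, chainWeight_reflect]
  linear_combination chainWeight x * chainWeight (x + 1) * (h1 - h2 + h4 / 2) + chainSinh n * h3

/-! ### The Green function of the grounded path -/

/-- The Green function of the antisymmetric part of the problem: the inverse, on positions
`0, …, 2 n`, of the path Laplacian plus a conductance `2` to the ground at each even position.
Positions are integers, which makes room for the fictitious neighbours `-1` and `2 n + 1`. -/
noncomputable def chainGreen (n : ℕ) (x y : ℤ) : ℝ :=
  √2 / chainSinh n * (chainHarmonic (min x y) * chainHarmonic (2 * n - max x y))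

theorem chainGreen_comm (n : ℕ) (x y : ℤ) : chainGreen n x y = chainGreen n y x := by
  rw [chainGreen, chainGreen, min_comm, max_comm]

theorem chainGreen_of_le (n : ℕ) {x y : ℤ} (h : x ≤ y) :
    chainGreen n x y = √2 / chainSinh n * (chainHarmonic x * chainHarmonic (2 * n - y)) := by
  rw [chainGreen, min_eq_left h, max_eq_right h]

theorem chainGreen_of_ge (n : ℕ) {x y : ℤ} (h : y ≤ x) :
    chainGreen n x y = √2 / chainSinh n * (chainHarmonic y * chainHarmonic (2 * n - x)) := by
  rw [chainGreen_comm, chainGreen_of_le n h]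

theorem chainGreen_pos (n : ℕ) (x y : ℤ) : 0 < chainGreen n x y :=
  mul_pos (div_pos (by positivity) (chainSinh_pos n))
    (mul_pos (chainHarmonic_pos _) (chainHarmonic_pos _))

theorem chainGreen_reflect (n : ℕ) (x y : ℤ) : chainGreen n (2 * n - x) (2 * n - y) =
    chainGreen n x y := by
  rcases le_total x y with h | h
  · rw [chainGreen_of_le n h, chainGreen_of_ge n (by omega), sub_sub_cancel,
      mul_comm (chainHarmonic x)]
  · rw [chainGreen_of_ge n h, chainGreen_of_le n (by omega), sub_sub_cancel,
      mul_comm (chainHarmonic y)]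

/-- The equation of an interior vertex holds at every integer position; at the two ends it becomes
the true equation through `chainGreen_neg_one` and `chainGreen_top_succ`. -/
theorem chainGreen_kirchhoff (n : ℕ) (x y : ℤ) :
    (if Even x then 4 else 2) * chainGreen n x y - chainGreen n (x - 1) y - chainGreen n (x + 1) y =
      if x = y then 1 else 0 := by
  have step : ∀ z : ℤ, chainHarmonic (z - 1) + chainHarmonic (z + 1) =
        (if Even z then 4 else 2) * chainHarmonic z := by
    intro z
    rcases Int.even_or_odd z with h | h
    · rw [chainHarmonic_even h, if_pos h]
    · rw [chainHarmonic_odd h, if_neg (Int.not_even_iff_odd.2 h)]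
  have hr := step (2 * n - x)
  have hx := step x
  have hpar : Even (2 * (n : ℤ) - x) ↔ Even x := by simp [Int.even_sub]
  simp only [hpar] at hr
  rw [show 2 * (n : ℤ) - x - 1 = 2 * n - (x + 1) by ring,
    show 2 * (n : ℤ) - x + 1 = 2 * n - (x - 1) by ring] at hr
  rcases lt_trichotomy x y with h | rfl | h
  · rw [if_neg h.ne, chainGreen_of_le n h.le, chainGreen_of_le n (by omega),
      chainGreen_of_le n (by omega)]
    linear_combination -(√2 / chainSinh n * chainHarmonic (2 * n - y)) * hx
  · rw [if_pos rfl, chainGreen_of_le n le_rfl, chainGreen_of_le n (by omega),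
      chainGreen_of_ge n (by omega)]
    have hw := chainHarmonic_wronskian n x
    have hs := (chainSinh_pos n).ne'
    have h1 : √2 / chainSinh n * (√2 / 2 * chainSinh n) = 1 := by
      field_simp
      linear_combination sqrt_two_mul_self
    linear_combination -(√2 / chainSinh n * chainHarmonic (2 * n - x)) * hx +
        √2 / chainSinh n * hw + h1
  · rw [if_neg h.ne', chainGreen_of_ge n h.le, chainGreen_of_ge n (by omega),
      chainGreen_of_ge n (by omega)]
    linear_combination -(√2 / chainSinh n * chainHarmonic y) * hr

theorem chainGreen_neg_one (n : ℕ) {y : ℤ} (hy : 0 ≤ y) : chainGreen n (-1) y =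
    chainGreen n 0 y := by
  rw [chainGreen_of_le n (by omega), chainGreen_of_le n hy, chainHarmonic_neg_one]

theorem chainGreen_top_succ (n : ℕ) {y : ℤ} (hy : y ≤ 2 * n) :
    chainGreen n (2 * n + 1) y = chainGreen n (2 * n) y := by
  rw [chainGreen_of_ge n (by omega), chainGreen_of_ge n hy,
    show 2 * (n : ℤ) - (2 * n + 1) = -1 by ring, chainHarmonic_neg_one, sub_self]

theorem chainGreen_le_of_le (n : ℕ) {x x' y : ℤ} (h0 : -1 ≤ x) (h : x ≤ x') (h' : x' ≤ y) :
    chainGreen n x y ≤ chainGreen n x' y := by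
  rw [chainGreen_of_le n (h.trans h'), chainGreen_of_le n h']
  have := chainSinh_pos n
  have := chainHarmonic_pos (2 * n - y)
  have := chainHarmonic_mono h0 h
  gcongr

theorem chainGreen_le_of_ge (n : ℕ) {x x' y : ℤ} (h0 : x ≤ 2 * n + 1) (h : x' ≤ x) (h' : y ≤ x') :
    chainGreen n x y ≤ chainGreen n x' y := by
  rw [← chainGreen_reflect n x, ← chainGreen_reflect n x']
  exact chainGreen_le_of_le n (by omega) (by omega) (by omega)

theorem chainGreen_self_le_of_even (n : ℕ) {y : ℤ} (h : Even y) (h0 : 0 ≤ y) (h1 : y ≤ 2 * n) :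
    chainGreen n y y ≤ 1 / 2 := by
  have := chainGreen_kirchhoff n y y
  rw [if_pos h, if_pos rfl] at this
  linarith [chainGreen_le_of_le n (x := y - 1) (x' := y) (y := y) (by omega) (by omega) le_rfl,
    chainGreen_le_of_ge n (x := y + 1) (x' := y) (y := y) (by omega) (by omega) le_rfl]

/-- The neighbours of an odd position carry at most a third of its potential, whence the
upper bound. -/
theorem chainGreen_self_bounds_of_odd (n : ℕ) {y : ℤ} (h : Odd y) (h0 : 0 ≤ y) (h1 : y ≤ 2 * n) :
    1 / 2 ≤ chainGreen n y y ∧ chainGreen n y y ≤ 3 / 4 := by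
  obtain ⟨m, rfl⟩ := h
  have e0 := chainGreen_kirchhoff n (2 * m + 1) (2 * m + 1)
  have e1 := chainGreen_kirchhoff n (2 * m + 1 + 1) (2 * m + 1)
  have e2 := chainGreen_kirchhoff n (2 * m + 1 - 1) (2 * m + 1)
  rw [if_neg (by simp), if_pos rfl] at e0
  rw [if_pos (by simp), if_neg (by omega)] at e1 e2
  rw [add_sub_cancel_right] at e1
  rw [sub_add_cancel] at e2
  have p1 := chainGreen_pos n (2 * m + 1 + 1) (2 * m + 1)
  have p2 := chainGreen_pos n (2 * m + 1 - 1) (2 * m + 1)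
  have d1 := chainGreen_le_of_ge n (x := 2 * m + 1 + 1 + 1) (x' := 2 * m + 1 + 1) (y := 2 * m + 1)
    (by omega) (by omega) (by omega)
  have d2 := chainGreen_le_of_le n (x := 2 * m + 1 - 1 - 1) (x' := 2 * m + 1 - 1) (y := 2 * m + 1)
    (by omega) (by omega) (by omega)
  constructor <;> linarith

/-- The product of two hyperbolic cosines turned into a sum: apart from a term depending only on
the distance, only the offset `2 n - x - y` of the pair from the centre matters. -/
theorem chainGreen_eq_chainCosh (n : ℕ) {x y : ℤ} (h : x ≤ y) :
    chainGreen n x y = √2 / (2 * chainSinh n) * (chainWeight x * chainWeight y) *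
      (chainCosh (2 * n + 2 - (y - x)) + chainCosh (2 * n - x - y)) := by
  have h1 := chainCosh_mul (2 * n - y + 1) (x + 1)
  rw [show 2 * (n : ℤ) - y + 1 + (x + 1) = 2 * n + 2 - (y - x) by ring,
    show 2 * (n : ℤ) - y + 1 - (x + 1) = 2 * n - x - y by ring] at h1
  have hs := (chainSinh_pos n).ne'
  rw [chainGreen_of_le n h, chainHarmonic, chainHarmonic, chainWeight_reflect]
  field_simp
  linear_combination 2 * chainWeight x * chainWeight y * h1

/-! ### Widening a pair increases the resistance -/

/-- The resistance distance between vertices at positions `x` and `y`, on the same side of the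
chain if `ε = 1` and on opposite sides if `ε = -1` (see `resistanceDist_hexChain`). -/
noncomputable def chainResistance (n : ℕ) (ε : ℝ) (x y : ℤ) : ℝ :=
  (|(x : ℝ) - y| + chainGreen n x x + chainGreen n y y - 2 * ε * chainGreen n x y) / 2

theorem chainResistance_comm (n : ℕ) (ε : ℝ) (x y : ℤ) :
    chainResistance n ε x y = chainResistance n ε y x := by
  rw [chainResistance, chainResistance, abs_sub_comm, chainGreen_comm n x y]
  ring

theorem chainResistance_reflect (n : ℕ) (ε : ℝ) (x y : ℤ) :
    chainResistance n ε (2 * n - x) (2 * n - y) = chainResistance n ε x y := by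
  simp only [chainResistance, chainGreen_reflect]
  push_cast
  rw [show (2 * n - x : ℝ) - (2 * n - y) = y - x by ring, abs_sub_comm]

/-- Moving the right endpoint one hexagon outwards lengthens the symmetric part by `2`, more than
the Green function, whose values are at most `1 / 2` or `3 / 4`, can compensate. -/
theorem chainResistance_le_add_two (n : ℕ) {ε : ℝ} (hε : |ε| ≤ 1) {x y : ℤ} (hx : 0 ≤ x)
    (hxy : x ≤ y) (hy : y + 2 ≤ 2 * n) :
    chainResistance n ε x y ≤ chainResistance n ε x (y + 2) := by
  have hxy' : (x : ℝ) ≤ y := by exact_mod_cast hxy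
  have h1 := chainGreen_le_of_le n (x := x) (x' := y) (y := y) (by omega) hxy le_rfl
  have h2 := chainGreen_le_of_le n (x := x) (x' := y + 2) (y := y + 2) (by omega) (by omega) le_rfl
  have p1 := chainGreen_pos n x y
  have p2 := chainGreen_pos n x (y + 2)
  have hε' := abs_le.1 hε
  have hcross : 2 * ε * (chainGreen n x (y + 2) - chainGreen n x y) ≤
        2 + chainGreen n (y + 2) (y + 2) - chainGreen n y y := by
    -- Both values of the Green function are positive and at most the one on the diagonal.
    have hmax : 2 * ε * (chainGreen n x (y + 2) - chainGreen n x y) ≤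
        2 * max (chainGreen n (y + 2) (y + 2)) (chainGreen n y y) := by
      rcases le_total (chainGreen n x y) (chainGreen n x (y + 2)) with h | h
      · have := le_max_left (chainGreen n (y + 2) (y + 2)) (chainGreen n y y)
        nlinarith
      · have := le_max_right (chainGreen n (y + 2) (y + 2)) (chainGreen n y y)
        nlinarith
    refine hmax.trans ?_
    rcases Int.even_or_odd y with h | h
    · have b1 := chainGreen_self_le_of_even n h (by omega) (by omega)
      have b2 := chainGreen_self_le_of_even n (h.add even_two) (by omega) (by omega)
      have p3 := chainGreen_pos n (y + 2) (y + 2)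
      have : max (chainGreen n (y + 2) (y + 2)) (chainGreen n y y) ≤ 1 / 2 := max_le b2 b1
      linarith
    · have b1 := chainGreen_self_bounds_of_odd n h (by omega) (by omega)
      have b2 := chainGreen_self_bounds_of_odd n (h.add_even even_two) (by omega) (by omega)
      have : max (chainGreen n (y + 2) (y + 2)) (chainGreen n y y) ≤ 3 / 4 := max_le b2.2 b1.2
      linarith [b1.2, b2.1]
  rw [chainResistance, chainResistance, abs_of_nonpos (by linarith),
    abs_of_nonpos (by push_cast; linarith)]
  push_cast
  linarith

theorem chainResistance_le_right (n : ℕ) {ε : ℝ} (hε : |ε| ≤ 1) {x y z : ℤ} (hx : 0 ≤ x)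
    (hxy : x ≤ y) (hyz : y ≤ z) (hz : z ≤ 2 * n) (hpar : Even (z - y)) :
    chainResistance n ε x y ≤ chainResistance n ε x z := by
  have key : ∀ k : ℕ, y + 2 * k ≤ 2 * n →
      chainResistance n ε x y ≤ chainResistance n ε x (y + 2 * k) := by
    intro k
    induction k with
    | zero => intro _; simp
    | succ k ih =>
      intro hk
      push_cast at hk ⊢
      refine (ih (by omega)).trans ?_
      rw [show y + 2 * ((k : ℤ) + 1) = y + 2 * k + 2 by ring]
      exact chainResistance_le_add_two n hε hx (by omega) (by omega)
  obtain ⟨m, hm⟩ := hpar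
  have := key m.toNat (by omega)
  rwa [show y + 2 * (m.toNat : ℤ) = z by omega] at this

/-- A pair contained in another one, with endpoints of the same parities, has the smaller
resistance. -/
theorem chainResistance_le_of_subset (n : ℕ) {ε : ℝ} (hε : |ε| ≤ 1) {x x' y y' : ℤ} (hx : 0 ≤ x)
    (hxx : x ≤ x') (hxy : x' ≤ y') (hyy : y' ≤ y) (hy : y ≤ 2 * n)
    (hpx : Even (x' - x)) (hpy : Even (y - y')) :
    chainResistance n ε x' y' ≤ chainResistance n ε x y := by
  refine (chainResistance_le_right n hε (by omega) hxy hyy hy hpy).trans ?_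
  -- The reflection turns moving the left endpoint into moving the right one.
  rw [← chainResistance_reflect n ε x', ← chainResistance_reflect n ε x,
    chainResistance_comm, chainResistance_comm n ε (2 * n - x)]
  exact chainResistance_le_right n hε (by omega) (by omega) (by omega) (by omega)
    (by rwa [show 2 * (n : ℤ) - x - (2 * n - x') = x' - x by ring])

/-! ### Neighbouring pairs are best placed at the centre -/

/-- `2 cosh (2 θ) = 6`. -/
theorem chainCosh_add_two_add_sub_two (k : ℤ) : chainCosh (k + 2) + chainCosh (k - 2) =
    6 * chainCosh k := by
  have h0 := chainCosh_succ_add_pred k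
  have h1 := chainCosh_succ_add_pred (k + 1)
  have h2 := chainCosh_succ_add_pred (k - 1)
  rw [add_assoc, add_sub_cancel_right] at h1
  rw [sub_add_cancel, sub_sub] at h2
  norm_num at h1 h2
  linear_combination h1 + h2 + 2 * √2 * h0 + 4 * chainCosh k * sqrt_two_mul_self

theorem chainGreen_even_even (n : ℕ) (j : ℤ) : chainGreen n (2 * j) (2 * j) =
    √2 / (2 * chainSinh n) / 2 * (chainCosh (2 * n + 2) + chainCosh (2 * n - 4 * j)) := by
  rw [chainGreen_eq_chainCosh n le_rfl, chainWeight_even (even_two_mul j)]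
  rw [show 2 * (n : ℤ) + 2 - (2 * j - 2 * j) = 2 * n + 2 by ring,
    show 2 * (n : ℤ) - 2 * j - 2 * j = 2 * n - 4 * j by ring]
  linear_combination √2 / (2 * chainSinh n) / 4 *
    (chainCosh (2 * n + 2) + chainCosh (2 * n - 4 * j)) * sqrt_two_mul_self

theorem chainGreen_even_even_succ (n : ℕ) (j : ℤ) : chainGreen n (2 * j) (2 * j + 2) =
    √2 / (2 * chainSinh n) / 2 * (chainCosh (2 * n) + chainCosh (2 * n - 4 * j - 2)) := by
  rw [chainGreen_eq_chainCosh n (by omega), chainWeight_even (even_two_mul j),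
    chainWeight_even ((even_two_mul j).add even_two)]
  rw [show 2 * (n : ℤ) + 2 - (2 * j + 2 - 2 * j) = 2 * n by ring,
    show 2 * (n : ℤ) - 2 * j - (2 * j + 2) = 2 * n - 4 * j - 2 by ring]
  linear_combination √2 / (2 * chainSinh n) / 4 *
    (chainCosh (2 * n) + chainCosh (2 * n - 4 * j - 2)) * sqrt_two_mul_self

theorem chainGreen_odd_odd (n : ℕ) (j : ℤ) : chainGreen n (2 * j + 1) (2 * j + 1) =
    √2 / (2 * chainSinh n) * (chainCosh (2 * n + 2) + chainCosh (2 * n - 4 * j - 2)) := by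
  rw [chainGreen_eq_chainCosh n le_rfl, chainWeight_odd (odd_two_mul_add_one j)]
  rw [show 2 * (n : ℤ) + 2 - (2 * j + 1 - (2 * j + 1)) = 2 * n + 2 by ring,
    show 2 * (n : ℤ) - (2 * j + 1) - (2 * j + 1) = 2 * n - 4 * j - 2 by ring]
  ring

theorem chainGreen_odd_odd_succ (n : ℕ) (j : ℤ) : chainGreen n (2 * j + 1) (2 * j + 1 + 2) =
    √2 / (2 * chainSinh n) * (chainCosh (2 * n) + chainCosh (2 * n - 4 * j - 4)) := by
  rw [chainGreen_eq_chainCosh n (by omega), chainWeight_odd (odd_two_mul_add_one j),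
    chainWeight_odd ((odd_two_mul_add_one j).add_even even_two)]
  rw [show 2 * (n : ℤ) + 2 - (2 * j + 1 + 2 - (2 * j + 1)) = 2 * n by ring,
    show 2 * (n : ℤ) - (2 * j + 1) - (2 * j + 1 + 2) = 2 * n - 4 * j - 4 by ring]
  ring

theorem chainGreen_even_odd (n : ℕ) (j : ℤ) : chainGreen n (2 * j) (2 * j + 1) =
    √2 / (2 * chainSinh n) * (√2 / 2) *
      (chainCosh (2 * n + 1) + chainCosh (2 * n - 4 * j - 1)) := by
  rw [chainGreen_eq_chainCosh n (by omega), chainWeight_mul_chainWeight_succ]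
  rw [show 2 * (n : ℤ) + 2 - (2 * j + 1 - 2 * j) = 2 * n + 1 by ring,
    show 2 * (n : ℤ) - 2 * j - (2 * j + 1) = 2 * n - 4 * j - 1 by ring]

theorem chainGreen_scale_pos (n : ℕ) : 0 < √2 / (2 * chainSinh n) :=
  div_pos (by positivity) (mul_pos two_pos (chainSinh_pos n))

theorem chainResistance_even_even_add_two_le (n : ℕ) {j l : ℤ}
    (h : |2 * (n : ℤ) - 4 * j - 2| ≤ |2 * (n : ℤ) - 4 * l - 2|) :
    chainResistance n 1 (2 * j) (2 * j + 2) ≤ chainResistance n 1 (2 * l) (2 * l + 2) := by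
  have key : ∀ m : ℤ, chainResistance n 1 (2 * m) (2 * m + 2) = 1 + √2 / (2 * chainSinh n) *
      ((chainCosh (2 * n + 2) - chainCosh (2 * n)) / 2 + chainCosh (2 * n - 4 * m - 2)) := by
    intro m
    -- The diagonal terms sit at offsets `± 2` from the offset of the mutual term.
    have h6 := chainCosh_add_two_add_sub_two (2 * n - 4 * m - 2)
    rw [sub_add_cancel, show 2 * (n : ℤ) - 4 * m - 2 - 2 = 2 * n - 4 * (m + 1) by ring] at h6
    have hd : |((2 * m : ℤ) : ℝ) - ((2 * m + 2 : ℤ) : ℝ)| = 2 := by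
      push_cast; rw [sub_add_cancel_left, abs_neg, abs_two]
    rw [chainResistance, hd, chainGreen_even_even_succ, chainGreen_even_even,
      show 2 * m + 2 = 2 * (m + 1) by ring, chainGreen_even_even]
    linear_combination √2 / (2 * chainSinh n) / 4 * h6
  rw [key, key]
  have := chainCosh_le_chainCosh h
  have := chainGreen_scale_pos n
  gcongr

theorem chainResistance_odd_odd_add_two_le (n : ℕ) {j l : ℤ}
    (h : |2 * (n : ℤ) - 4 * j - 4| ≤ |2 * (n : ℤ) - 4 * l - 4|) :
    chainResistance n 1 (2 * j + 1) (2 * j + 1 + 2) ≤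
      chainResistance n 1 (2 * l + 1) (2 * l + 1 + 2) := by
  have key : ∀ m : ℤ, chainResistance n 1 (2 * m + 1) (2 * m + 1 + 2) = 1 + √2 / (2 * chainSinh n) *
      (chainCosh (2 * n + 2) - chainCosh (2 * n) + 2 * chainCosh (2 * n - 4 * m - 4)) := by
    intro m
    have h6 := chainCosh_add_two_add_sub_two (2 * n - 4 * m - 4)
    rw [show 2 * (n : ℤ) - 4 * m - 4 + 2 = 2 * n - 4 * m - 2 by ring,
      show 2 * (n : ℤ) - 4 * m - 4 - 2 = 2 * n - 4 * (m + 1) - 2 by ring] at h6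
    have hd : |((2 * m + 1 : ℤ) : ℝ) - ((2 * m + 1 + 2 : ℤ) : ℝ)| = 2 := by
      push_cast; rw [sub_add_cancel_left, abs_neg, abs_two]
    rw [chainResistance, hd, chainGreen_odd_odd_succ, chainGreen_odd_odd,
      show 2 * m + 1 + 2 = 2 * (m + 1) + 1 by ring, chainGreen_odd_odd]
    linear_combination √2 / (2 * chainSinh n) / 2 * h6
  rw [key, key]
  have := chainCosh_le_chainCosh h
  have := chainGreen_scale_pos n
  gcongr

/-- The three hyperbolic cosines combine into the single one of `2 n - 4 j - 2`, although the
mutual term enters with a minus sign. -/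
theorem chainResistance_even_odd_le (n : ℕ) {j l : ℤ}
    (h : |2 * (n : ℤ) - 4 * j - 2| ≤ |2 * (n : ℤ) - 4 * l - 2|) :
    chainResistance n 1 (2 * j) (2 * j + 1) ≤ chainResistance n 1 (2 * l) (2 * l + 1) := by
  have key : ∀ m : ℤ, chainResistance n 1 (2 * m) (2 * m + 1) = 1 / 2 + √2 / (2 * chainSinh n) *
      ((3 * chainCosh (2 * n + 2) - 2 * √2 * chainCosh (2 * n + 1)) / 4 +
        chainCosh (2 * n - 4 * m - 2) / 4) := by
    intro m
    -- The two diagonal terms have offsets `± 1` from that of the mutual term.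
    have h2 := chainCosh_succ_add_pred (2 * n - 4 * m - 1)
    rw [sub_add_cancel, sub_sub (2 * (n : ℤ) - 4 * m) 1 1, one_add_one_eq_two] at h2
    have hd : |((2 * m : ℤ) : ℝ) - ((2 * m + 1 : ℤ) : ℝ)| = 1 := by
      push_cast; rw [sub_add_cancel_left, abs_neg, abs_one]
    rw [chainResistance, hd, chainGreen_even_odd, chainGreen_even_even, chainGreen_odd_odd]
    linear_combination √2 / (2 * chainSinh n) / 4 * h2
  rw [key, key]
  have := chainCosh_le_chainCosh h
  have := chainGreen_scale_pos n
  gcongr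

theorem chainGreen_even_self_le (n : ℕ) {j l : ℤ} (h : |2 * (n : ℤ) - 4 * j| ≤
    |2 * (n : ℤ) - 4 * l|) :
    chainGreen n (2 * j) (2 * j) ≤ chainGreen n (2 * l) (2 * l) := by
  rw [chainGreen_even_even, chainGreen_even_even]
  have := chainCosh_le_chainCosh h
  have := chainGreen_scale_pos n
  gcongr

theorem chainGreen_odd_self_le (n : ℕ) {j l : ℤ}
    (h : |2 * (n : ℤ) - 4 * j - 2| ≤ |2 * (n : ℤ) - 4 * l - 2|) :
    chainGreen n (2 * j + 1) (2 * j + 1) ≤ chainGreen n (2 * l + 1) (2 * l + 1) := by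
  rw [chainGreen_odd_odd, chainGreen_odd_odd]
  have := chainCosh_le_chainCosh h
  have := chainGreen_scale_pos n
  gcongr

theorem chainGreen_even_odd_le (n : ℕ) {j l : ℤ}
    (h : |2 * (n : ℤ) - 4 * j - 1| ≤ |2 * (n : ℤ) - 4 * l - 1|) :
    chainGreen n (2 * j) (2 * j + 1) ≤ chainGreen n (2 * l) (2 * l + 1) := by
  rw [chainGreen_even_odd, chainGreen_even_odd]
  have := chainCosh_le_chainCosh h
  have := chainGreen_scale_pos n
  gcongr

theorem chainResistance_neg_one_self (n : ℕ) (x : ℤ) :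
    chainResistance n (-1) x x = 2 * chainGreen n x x := by
  rw [chainResistance, sub_self, abs_zero]
  ring

theorem chainResistance_neg_one_even_odd_le (n : ℕ) {j l : ℤ}
    (h0 : |2 * (n : ℤ) - 4 * j| ≤ |2 * (n : ℤ) - 4 * l|)
    (h1 : |2 * (n : ℤ) - 4 * j - 1| ≤ |2 * (n : ℤ) - 4 * l - 1|)
    (h2 : |2 * (n : ℤ) - 4 * j - 2| ≤ |2 * (n : ℤ) - 4 * l - 2|) :
    chainResistance n (-1) (2 * j) (2 * j + 1) ≤ chainResistance n (-1) (2 * l) (2 * l + 1) := by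
  have hd : ∀ m : ℤ, |((2 * m : ℤ) : ℝ) - ((2 * m + 1 : ℤ) : ℝ)| = 1 := by
    intro m
    push_cast; rw [sub_add_cancel_left, abs_neg, abs_one]
  rw [chainResistance, chainResistance, hd, hd]
  linarith [chainGreen_even_self_le n h0, chainGreen_even_odd_le n h1, chainGreen_odd_self_le n h2]

/-! ### The Laplacian of the chain in coordinates -/

open Matrix in
theorem lapMatrix_mulVec_eq_sum {V : Type*} [Fintype V] [DecidableEq V] (G : SimpleGraph V)
    [DecidableRel G.Adj] (φ : V → ℝ) (a : V) :
    (G.lapMatrix ℝ *ᵥ φ) a = ∑ b, if G.Adj a b then φ a - φ b else 0 := by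
  rw [SimpleGraph.lapMatrix_mulVec_apply, ← Finset.sum_filter, Finset.sum_sub_distrib,
    Finset.sum_const, nsmul_eq_mul, ← SimpleGraph.card_neighborFinset_eq_degree,
    SimpleGraph.neighborFinset_eq_filter]

namespace HexVertex

variable {n : ℕ}

/-- The four families of vertices as a sum type. -/
def equivSum (n : ℕ) : HexVertex n ≃ (Fin (n + 1) ⊕ Fin (n + 1)) ⊕ (Fin n ⊕ Fin n) where
  toFun
    | .p i => .inl (.inl i)
    | .q i => .inl (.inr i)
    | .u i => .inr (.inl i)
    | .v i => .inr (.inr i)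
  invFun
    | .inl (.inl i) => .p i
    | .inl (.inr i) => .q i
    | .inr (.inl i) => .u i
    | .inr (.inr i) => .v i
  left_inv a := by cases a <;> rfl
  right_inv a := by rcases a with (_ | _) | (_ | _) <;> rfl

theorem sum_eq (f : HexVertex n → ℝ) :
    ∑ a, f a = ∑ i, f (.p i) + ∑ i, f (.q i) + (∑ i, f (.u i) + ∑ i, f (.v i)) := by
  rw [← (equivSum n).symm.sum_comp, Fintype.sum_sum_type, Fintype.sum_sum_type,
    Fintype.sum_sum_type]
  rfl

/-- The position of a vertex on the path `p_0, u_0, p_1, u_1, …, p_n`, or on its mirror image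
`q_0, v_0, …, q_n`. -/
def pos : HexVertex n → ℤ
  | .p i => 2 * (i : ℕ)
  | .q i => 2 * (i : ℕ)
  | .u i => 2 * (i : ℕ) + 1
  | .v i => 2 * (i : ℕ) + 1

/-- The side of the chain: `1` for the `p` and `u` vertices, `-1` for the `q` and `v` vertices. -/
def side : HexVertex n → ℝ
  | .p _ => 1
  | .q _ => -1
  | .u _ => 1
  | .v _ => -1

theorem pos_nonneg (a : HexVertex n) : 0 ≤ a.pos := by
  cases a <;> simp only [pos] <;> omega

theorem pos_le (a : HexVertex n) : a.pos ≤ 2 * n := by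
  cases a <;> simp only [pos] <;> omega

/-- The vertices `u_k` adjacent to `p_i`, like the `v_k` adjacent to `q_i`, sit at `2 i + 1` and
`2 i - 1`, as far as these exist. -/
theorem sum_rung_neighbors (h : ℤ → ℝ) (i : Fin (n + 1)) :
    (∑ k : Fin n, if i = k.castSucc ∨ i = k.succ then h (2 * (k : ℕ) + 1) else 0) =
      (if (i : ℕ) < n then h (2 * (i : ℕ) + 1) else 0) +
        (if 0 < (i : ℕ) then h (2 * (i : ℕ) - 1) else 0) := by
  have hsplit : ∀ k : Fin n, (if i = k.castSucc ∨ i = k.succ then h (2 * (k : ℕ) + 1) else 0) =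
      (if i = k.castSucc then h (2 * (k : ℕ) + 1) else 0) +
        (if i = k.succ then h (2 * (k : ℕ) + 1) else 0) := by
    intro k
    by_cases h1 : i = k.castSucc
    · have h2 : i ≠ k.succ := by rw [h1]; exact (Fin.castSucc_lt_succ).ne
      simp [h1, h1 ▸ h2]
    · simp [h1]
  rw [Finset.sum_congr rfl fun k _ => hsplit k, Finset.sum_add_distrib]
  congr 1
  · split_ifs with hi
    · rw [Finset.sum_eq_single (⟨i, hi⟩ : Fin n)]
      · exact if_pos (Fin.ext rfl)
      · intro k _ hk
        exact if_neg fun h' => hk (Fin.ext (by simp [h']))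
      · simp
    · refine Finset.sum_eq_zero fun k _ => if_neg fun h' => hi ?_
      rw [h']; exact k.isLt
  · split_ifs with hi
    · rw [Finset.sum_eq_single (⟨i - 1, by omega⟩ : Fin n)]
      · rw [if_pos (Fin.ext (by simp; omega))]
        congr 1
        push_cast [Nat.cast_sub (show 1 ≤ (i : ℕ) from hi)]
        ring
      · intro k _ hk
        exact if_neg fun h' => hk (Fin.ext (by simp [h']))
      · simp
    · refine Finset.sum_eq_zero fun k _ => if_neg fun h' => hi ?_
      rw [h']; simp

end HexVertex

theorem sum_hexChain_p {n : ℕ} (F : HexVertex n → ℝ) (i : Fin (n + 1)) :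
    (∑ b, if (hexChain n).Adj (.p i) b then F b else 0) =
      F (.q i) + ∑ k : Fin n, if i = k.castSucc ∨ i = k.succ then F (.u k) else 0 := by
  rw [HexVertex.sum_eq]
  simp [hexChain, HexVertex.Edge]

theorem sum_hexChain_q {n : ℕ} (F : HexVertex n → ℝ) (i : Fin (n + 1)) :
    (∑ b, if (hexChain n).Adj (.q i) b then F b else 0) =
      F (.p i) + ∑ k : Fin n, if i = k.castSucc ∨ i = k.succ then F (.v k) else 0 := by
  rw [HexVertex.sum_eq]
  simp [hexChain, HexVertex.Edge]

theorem sum_fin_castSucc_or_succ {n : ℕ} (f : Fin (n + 1) → ℝ) (k : Fin n) :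
    (∑ i, if i = k.castSucc ∨ i = k.succ then f i else 0) = f k.castSucc + f k.succ := by
  rw [← Finset.sum_filter, ← Finset.sum_pair (f := f) (Fin.castSucc_lt_succ (i := k)).ne]
  congr 1
  ext i
  simp

theorem sum_hexChain_u {n : ℕ} (F : HexVertex n → ℝ) (k : Fin n) :
    (∑ b, if (hexChain n).Adj (.u k) b then F b else 0) = F (.p k.castSucc) + F (.p k.succ) := by
  rw [HexVertex.sum_eq, ← sum_fin_castSucc_or_succ (fun i => F (.p i))]
  simp [hexChain, HexVertex.Edge]

theorem sum_hexChain_v {n : ℕ} (F : HexVertex n → ℝ) (k : Fin n) :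
    (∑ b, if (hexChain n).Adj (.v k) b then F b else 0) = F (.q k.castSucc) + F (.q k.succ) := by
  rw [HexVertex.sum_eq, ← sum_fin_castSucc_or_succ (fun i => F (.q i))]
  simp [hexChain, HexVertex.Edge]

/-! ### The potential of a unit source -/

/-- The potential at position `x` and side `σ` of a unit source at position `y` and side `τ`,
with its symmetric part `-|x - y| / 2` and its antisymmetric part `σ τ G(x, y)`, each halved. -/
noncomputable def stripPotential (n : ℕ) (y : ℤ) (τ : ℝ) (x : ℤ) (σ : ℝ) : ℝ :=
  (-|(x : ℝ) - y| / 2 + σ * τ * chainGreen n x y) / 2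

theorem abs_laplacian (x y : ℤ) :
    |((x - 1 : ℤ) : ℝ) - y| + |((x + 1 : ℤ) : ℝ) - y| - 2 * |(x : ℝ) - y| =
      if x = y then 2 else 0 := by
  push_cast
  rcases lt_trichotomy x y with h | rfl | h
  · have : (x : ℝ) + 1 ≤ y := by exact_mod_cast h
    rw [if_neg h.ne, abs_of_nonpos (by linarith), abs_of_nonpos (by linarith),
      abs_of_nonpos (by linarith)]
    ring
  · simp; norm_num
  · have : (y : ℝ) + 1 ≤ x := by exact_mod_cast h
    rw [if_neg h.ne', abs_of_nonneg (by linarith), abs_of_nonneg (by linarith),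
      abs_of_nonneg (by linarith)]
    ring

/-- The last summand on the left is the current through the rung. -/
theorem stripPotential_laplacian (n : ℕ) (y : ℤ) (τ : ℝ) (x : ℤ) (σ : ℝ) :
    2 * stripPotential n y τ x σ - stripPotential n y τ (x - 1) σ - stripPotential n y τ (x + 1) σ +
      (if Even x then stripPotential n y τ x σ - stripPotential n y τ x (-σ) else 0) =
      if x = y then (1 + σ * τ) / 2 else 0 := by
  have h1 := abs_laplacian x y
  have h2 := chainGreen_kirchhoff n x y
  simp only [stripPotential]
  split_ifs at * <;> linear_combination h1 / 4 + σ * τ / 2 * h2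

theorem stripPotential_zero_sub (n : ℕ) {y : ℤ} (hy : 0 ≤ y) (τ σ : ℝ) :
    stripPotential n y τ 0 σ - stripPotential n y τ (-1) σ = 1 / 4 := by
  have : (0 : ℝ) ≤ y := by exact_mod_cast hy
  rw [stripPotential, stripPotential, chainGreen_neg_one n hy,
    abs_of_nonpos (by push_cast; linarith),
    abs_of_nonpos (by push_cast; linarith)]
  push_cast
  ring

theorem stripPotential_top_sub (n : ℕ) {y : ℤ} (hy : y ≤ 2 * n) (τ σ : ℝ) :
    stripPotential n y τ (2 * n) σ - stripPotential n y τ (2 * n + 1) σ = 1 / 4 := by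
  have : (y : ℝ) ≤ 2 * n := by exact_mod_cast hy
  rw [stripPotential, stripPotential, chainGreen_top_succ n hy,
    abs_of_nonneg (by push_cast; linarith),
    abs_of_nonneg (by push_cast; linarith)]
  push_cast
  ring

/-- `stripPotential` on the vertices, for a unit source at `b`. -/
noncomputable def sourcePotential {n : ℕ} (b a : HexVertex n) : ℝ :=
  stripPotential n b.pos b.side a.pos a.side

/-- The current which `sourcePotential` takes out of the chain: `1 / 4` at each of its four ends,
wherever the source is. -/
noncomputable def endDrain (n : ℕ) (x : ℤ) : ℝ :=
  (if x = 0 then 1 / 4 else 0) + (if x = 2 * n then 1 / 4 else 0)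

theorem stripPotential_rung (n : ℕ) {y : ℤ} (h0 : 0 ≤ y) (h1 : y ≤
    2 * n) (τ σ : ℝ) (i : Fin (n + 1)) :
    stripPotential n y τ (2 * (i : ℕ)) σ - stripPotential n y τ (2 * (i : ℕ)) (-σ) +
      ((if (i : ℕ) < n then stripPotential n y τ (2 * (i : ℕ)) σ -
          stripPotential n y τ (2 * (i : ℕ) + 1) σ else 0) +
        (if 0 < (i : ℕ) then stripPotential n y τ (2 * (i : ℕ)) σ -
          stripPotential n y τ (2 * (i : ℕ) - 1) σ else 0)) =
      (if (2 * (i : ℕ) : ℤ) = y then (1 + σ * τ) / 2 else 0) - endDrain n (2 * (i : ℕ)) := by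
  have hl := stripPotential_laplacian n y τ (2 * (i : ℕ)) σ
  rw [if_pos (even_two_mul _)] at hl
  have hr : (if (i : ℕ) < n then stripPotential n y τ (2 * (i : ℕ)) σ -
      stripPotential n y τ (2 * (i : ℕ) + 1) σ else 0) =
      stripPotential n y τ (2 * (i : ℕ)) σ - stripPotential n y τ (2 * (i : ℕ) + 1) σ -
        (if (2 * (i : ℕ) : ℤ) = 2 * n then 1 / 4 else 0) := by
    split_ifs with h h' h'
    · omega
    · ring
    · rw [h', stripPotential_top_sub n h1, sub_self]
    · omega
  have hL : (if 0 < (i : ℕ) then stripPotential n y τ (2 * (i : ℕ)) σ -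
      stripPotential n y τ (2 * (i : ℕ) - 1) σ else 0) =
      stripPotential n y τ (2 * (i : ℕ)) σ - stripPotential n y τ (2 * (i : ℕ) - 1) σ -
        (if (2 * (i : ℕ) : ℤ) = 0 then 1 / 4 else 0) := by
    split_ifs with h h' h'
    · omega
    · ring
    · rw [h', zero_sub, stripPotential_zero_sub n h0, sub_self]
    · omega
  rw [hr, hL, ← hl, endDrain]
  ring

open Matrix in
/-- The drain does not depend on the source `b`, so it cancels between two sources. -/
theorem lapMatrix_sourcePotential {n : ℕ} (b a : HexVertex n) :
    ((hexChain n).lapMatrix ℝ *ᵥ sourcePotential b) a =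
      (if a = b then 1 else 0) - endDrain n a.pos := by
  -- A vertex is determined by its position and its side.
  have hind : (if a = b then (1 : ℝ) else 0) =
      if a.pos = b.pos then (1 + a.side * b.side) / 2 else 0 := by
    cases a <;> cases b <;> simp [HexVertex.pos, HexVertex.side, Fin.ext_iff] <;> omega
  have hend : ∀ k : ℕ, endDrain n (2 * k + 1) = 0 := by
    intro k
    rw [endDrain, if_neg (by omega), if_neg (by omega), add_zero]
  have h0 := b.pos_nonneg
  have h1 := b.pos_le
  rw [hind, lapMatrix_mulVec_eq_sum]
  clear hind
  simp only [sourcePotential]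
  generalize b.pos = y at h0 h1 ⊢
  generalize b.side = τ
  rcases a with i | i | k | k
  · rw [sum_hexChain_p]
    simp only [HexVertex.pos, HexVertex.side]
    rw [HexVertex.sum_rung_neighbors (fun x => stripPotential n y τ (2 * (i : ℕ)) 1 -
      stripPotential n y τ x 1)]
    exact stripPotential_rung n h0 h1 τ 1 i
  · rw [sum_hexChain_q]
    simp only [HexVertex.pos, HexVertex.side]
    rw [HexVertex.sum_rung_neighbors (fun x => stripPotential n y τ (2 * (i : ℕ)) (-1) -
      stripPotential n y τ x (-1))]
    simpa using stripPotential_rung n h0 h1 τ (-1) i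
  · rw [sum_hexChain_u]
    simp only [HexVertex.pos, HexVertex.side]
    have := stripPotential_laplacian n y τ (2 * (k : ℕ) + 1) 1
    rw [if_neg (by simp), add_sub_cancel_right] at this
    rw [hend, sub_zero]
    refine Eq.trans ?_ this
    simp only [Fin.val_castSucc, Fin.val_succ]
    push_cast
    ring_nf
  · rw [sum_hexChain_v]
    simp only [HexVertex.pos, HexVertex.side]
    have := stripPotential_laplacian n y τ (2 * (k : ℕ) + 1) (-1)
    rw [if_neg (by simp), add_sub_cancel_right] at this
    rw [hend, sub_zero]
    refine Eq.trans ?_ this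
    simp only [Fin.val_castSucc, Fin.val_succ]
    push_cast
    ring_nf

theorem isUnitPotential_sourcePotential {n : ℕ} (a b : HexVertex n) :
    IsUnitPotential (hexChain n) a b (sourcePotential a - sourcePotential b) := by
  funext x
  rw [Matrix.mulVec_sub, Pi.sub_apply, Pi.sub_apply, lapMatrix_sourcePotential,
    lapMatrix_sourcePotential, Pi.single_apply, Pi.single_apply]
  ring

theorem resistanceDist_hexChain {n : ℕ} (a b : HexVertex n) :
    resistanceDist (hexChain n) a b = chainResistance n (a.side * b.side) a.pos b.pos := by
  have hsq : ∀ c : HexVertex n, c.side * c.side = 1 := by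
    intro c; cases c <;> simp [HexVertex.side]
  rw [resistanceDist_eq _ (isUnitPotential_sourcePotential a b)]
  simp only [Pi.sub_apply, sourcePotential, stripPotential, chainResistance]
  rw [hsq, hsq, sub_self, sub_self, abs_zero, abs_sub_comm (b.pos : ℝ),
    chainGreen_comm n b.pos a.pos]
  ring

/-! ### Extremal pairs -/

theorem theorem3p4 (n : ℕ) (hn : 1 ≤ n) :
    -- pairs `p_j, p_i` with `0 ≤ j < i ≤ n`
    (∀ (j i : Fin (n + 1)) (hji : j < i),
      resistanceDist (hexChain n) (.p 0) (.p (Fin.last n)) ≥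
          resistanceDist (hexChain n) (.p j) (.p i) ∧
        resistanceDist (hexChain n) (.p j) (.p i) ≥
          resistanceDist (hexChain n) (.p ⟨(n - 1) / 2, half_pred_lt_succ n⟩)
            (.p ⟨(n - 1) / 2 + 1, half_pred_succ_lt_succ hn⟩)) ∧
    -- pairs `q_j, p_i` with `0 ≤ j ≤ i ≤ n`
    (∀ (j i : Fin (n + 1)) (hji : j ≤ i),
      resistanceDist (hexChain n) (.q 0) (.p (Fin.last n)) ≥
          resistanceDist (hexChain n) (.q j) (.p i) ∧
        resistanceDist (hexChain n) (.q j) (.p i) ≥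
          resistanceDist (hexChain n) (.q ⟨n / 2, half_lt_succ n⟩)
            (.p ⟨n / 2, half_lt_succ n⟩)) ∧
    -- pairs `u_j, u_i` with `0 ≤ j < i ≤ n - 1`
    (∀ (j i : Fin n) (hji : j < i),
      resistanceDist (hexChain n) (.u ⟨0, hn⟩) (.u ⟨n - 1, pred_lt_of_one_le hn⟩) ≥
          resistanceDist (hexChain n) (.u j) (.u i) ∧
        resistanceDist (hexChain n) (.u j) (.u i) ≥
          resistanceDist (hexChain n) (.u ⟨(n - 1) / 2, half_pred_lt hn⟩)
            (.u ⟨(n - 1) / 2 + 1, half_pred_succ_lt hji⟩)) ∧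
    -- pairs `v_j, u_i` with `0 ≤ j ≤ i ≤ n - 1`
    (∀ (j i : Fin n) (hji : j ≤ i),
      resistanceDist (hexChain n) (.v ⟨0, hn⟩) (.u ⟨n - 1, pred_lt_of_one_le hn⟩) ≥
          resistanceDist (hexChain n) (.v j) (.u i) ∧
        resistanceDist (hexChain n) (.v j) (.u i) ≥
          resistanceDist (hexChain n) (.v ⟨n / 2, half_lt_of_one_le hn⟩)
            (.u ⟨n / 2, half_lt_of_one_le hn⟩)) ∧
    -- pairs `p_j, u_i` with `0 ≤ j ≤ i ≤ n - 1`
    (∀ (j i : Fin n) (hji : j ≤ i),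
      resistanceDist (hexChain n) (.p 0) (.u ⟨n - 1, pred_lt_of_one_le hn⟩) ≥
          resistanceDist (hexChain n) (.p j.castSucc) (.u i) ∧
        resistanceDist (hexChain n) (.p j.castSucc) (.u i) ≥
          resistanceDist (hexChain n) (.p ⟨n / 2, half_lt_succ n⟩)
            (.u ⟨n / 2, half_lt_of_one_le hn⟩)) ∧
    -- pairs `p_j, v_i` with `0 ≤ j ≤ i ≤ n - 1`
    (∀ (j i : Fin n) (hji : j ≤ i),
      resistanceDist (hexChain n) (.p 0) (.v ⟨n - 1, pred_lt_of_one_le hn⟩) ≥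
          resistanceDist (hexChain n) (.p j.castSucc) (.v i) ∧
        resistanceDist (hexChain n) (.p j.castSucc) (.v i) ≥
          resistanceDist (hexChain n) (.p ⟨n / 2, half_lt_succ n⟩)
            (.v ⟨n / 2, half_lt_of_one_le hn⟩)) := by
  have h1 : |(1 : ℝ)| ≤ 1 := by simp
  have hm1 : |(-1 : ℝ)| ≤ 1 := by simp
  simp only [resistanceDist_hexChain, HexVertex.pos, HexVertex.side, ge_iff_le, one_mul, mul_one,
    Fin.val_zero, Fin.val_last, Fin.val_castSucc, Fin.lt_def, Fin.le_def]
  refine ⟨?_, ?_, ?_, ?_, ?_, ?_⟩ <;> rintro ⟨j, hj⟩ ⟨i, hi⟩ hji <;> simp only at hji ⊢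
  -- Each pair is squeezed between the widest pair and the pair with the same left endpoint and
  -- adjacent (or equal) positions, which is then compared with the central one.
  · refine ⟨chainResistance_le_of_subset n h1 (by omega) (by omega) (by omega) (by omega)
      (by omega) (by grind) (by grind), ?_⟩
    refine le_trans ?_ (chainResistance_le_of_subset n h1 (x' := 2 * (j : ℤ))
      (y' := 2 * (j : ℤ) + 2)
      (by omega) le_rfl (by omega) (by omega) (by omega) (by grind) (by grind))
    have := chainResistance_even_even_add_two_le n (j := (((n - 1) / 2 : ℕ) : ℤ)) (l := j)
      (by grind)
    rwa [show 2 * (((n - 1) / 2 : ℕ) : ℤ) + 2 = 2 * (((n - 1) / 2 + 1 : ℕ) : ℤ) by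
      push_cast; ring] at this
  · refine ⟨chainResistance_le_of_subset n hm1 (by omega) (by omega) (by omega) (by omega)
      (by omega) (by grind) (by grind), ?_⟩
    refine le_trans ?_ (chainResistance_le_of_subset n hm1 (x' := 2 * (j : ℤ)) (y' := 2 * (j : ℤ))
      (by omega) le_rfl (by omega) (by omega) (by omega) (by grind) (by grind))
    rw [chainResistance_neg_one_self, chainResistance_neg_one_self]
    have := chainGreen_even_self_le n (j := ((n / 2 : ℕ) : ℤ)) (l := j) (by grind)
    linarith
  · refine ⟨chainResistance_le_of_subset n h1 (by omega) (by omega) (by omega) (by omega)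
      (by omega) (by grind) (by grind), ?_⟩
    refine le_trans ?_ (chainResistance_le_of_subset n h1 (x' := 2 * (j : ℤ) + 1)
      (y' := 2 * (j : ℤ) + 1 + 2)
      (by omega) le_rfl (by omega) (by omega) (by omega) (by grind) (by grind))
    have := chainResistance_odd_odd_add_two_le n (j := (((n - 1) / 2 : ℕ) : ℤ)) (l := j) (by grind)
    rwa [show 2 * (((n - 1) / 2 : ℕ) : ℤ) + 1 + 2 = 2 * (((n - 1) / 2 + 1 : ℕ) : ℤ) + 1 by
      push_cast; ring] at this
  · refine ⟨chainResistance_le_of_subset n hm1 (by omega) (by omega) (by omega) (by omega)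
      (by omega) (by grind) (by grind), ?_⟩
    refine le_trans ?_ (chainResistance_le_of_subset n hm1 (x' := 2 * (j : ℤ) + 1)
      (y' := 2 * (j : ℤ) + 1)
      (by omega) le_rfl (by omega) (by omega) (by omega) (by grind) (by grind))
    rw [chainResistance_neg_one_self, chainResistance_neg_one_self]
    have := chainGreen_odd_self_le n (j := ((n / 2 : ℕ) : ℤ)) (l := j) (by grind)
    linarith
  · refine ⟨chainResistance_le_of_subset n h1 (by omega) (by omega) (by omega) (by omega)
      (by omega) (by grind) (by grind), ?_⟩
    refine le_trans ?_ (chainResistance_le_of_subset n h1 (x' := 2 * (j : ℤ))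
      (y' := 2 * (j : ℤ) + 1)
      (by omega) le_rfl (by omega) (by omega) (by omega) (by grind) (by grind))
    exact chainResistance_even_odd_le n (by grind)
  · refine ⟨chainResistance_le_of_subset n hm1 (by omega) (by omega) (by omega) (by omega)
      (by omega) (by grind) (by grind), ?_⟩
    refine le_trans ?_ (chainResistance_le_of_subset n hm1 (x' := 2 * (j : ℤ))
      (y' := 2 * (j : ℤ) + 1)
      (by omega) le_rfl (by omega) (by omega) (by omega) (by grind) (by grind))
    exact chainResistance_neg_one_even_odd_le n (by grind) (by grind) (by grind)
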